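/- A base station (BS) serves $N>1$ users over $N_s$ sub-carriers in time slots $t=1,2,\dots$; user $i$ can be served on the sub-carriers of a set $\mathcal N_{s,i}$ with $|\mathcal N_{s,i}|>1$ (these sets may overlap). In each slot the BS chooses, at random and causally (i.e. depending on all that was realized in the earlier slots), a user $i$ (user choosing policy $\pi_u$), a sub-carrier in $\mathcal N_{s,i}$ (sub-carrier choosing policy $\pi_s$) and a transmission power among $p_1,\dots,p_n$ (power choosing policy $\pi_p$), the power being $p_k$ with probability $e_k(t)$, subject to $\sum_k e_k(t)p_k\le\bar p$ for every $t$; assume $p_k\le\bar p$ for some $k$. The adversary chooses a sub-carrier to block and a blocking power among $p'_1,\dots,p'_m$, with power budget $\tilde p$. A packet sent on a sub-carrier that is not blocked is received; a packet sent with power $p_k$ on a sub-carrier blocked with power $p'_j$ is received with probability $f_{k,j}\in[0,1]$. The age of a user is $1$ in the slot after it receives a packet, and otherwise increases by $1$ per slot; the ages at $t=1$ are arbitrary given positive integers. The average age of the system is $$\Delta=\limsup_{T\to\infty}\frac1T\sum_{t=1}^T\frac1N\sum_{i=1}^N\mathbb E[\text{age of user }i\text{ at slot }t].$$ Let $x$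 be such that $p'_x$ is the largest of the $p'_j$ with $p'_j\le\tilde p$, and let $\bar\psi$ be the adversarial action that in each slot blocks a uniformly random one of the $N_s$ sub-carriers, with power $p'_x$, independently of everything else that happens before or in that slot. The max-age policy schedules in each slot the user of largest age, ties being broken in favour of the lowest index; the uniform sub-carrier policy picks a uniformly random element of $\mathcal N_{s,i}$ when user $i$ is scheduled. Against $\bar\psi$, the max-age policy is an optimal user choosing policy, and when it schedules user $i$, choosing a sub-carrier of $\mathcal N_{s,i}$ uniformly is an optimal sub-carrier choosing policy. Precisely: 1. For every fixed sequence $(e(t))_{t\ge1}$ of power choosing pmfs: for every $\pi_s$, the max-age policy minimizes $\Delta$ among all $\pi_u$; and, with the max-age policy, the uniform sub-carrier policy minimizes $\Delta$ among all $\pi_s$. 2. For every causal BS algorithm $(\pi_u,\pi_s,\pi_p)$ that meets the power constraint, where $e_k(t)$ is the probability that $p_k$ is used in slot $t$, there is a power choosing policy $\rho$ such that the BS algorithm consisting of the max-age policy, the uniform sub-carrier policy and $\rho$ also meets it, and has an average age that is at most as large. 3. If instead the power constraint is imposed in every slot on the conditional probabilities given the realized past, there is a power choosing policy $\rho$ such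 that the BS algorithm consisting of the max-age policy, the uniform sub-carrier policy and $\rho$ meets the constraint and minimizes $\Delta$ among all causal BS algorithms that meet it. -/

import Mathlib

open Filter
open scoped ENNReal NNReal

noncomputable section

/-- The data of the communication network. Users, sub-carriers, transmission powers and blocking
powers are indexed by `Fin N`, `Fin Ns`, `Fin n` and `Fin m`. -/
structure JamNetwork where
  /-- number of users -/
  N : ℕ
  one_lt_N : 1 < N
  /-- number of sub-carriers -/
  Ns : ℕ
  /-- number of transmission powers of the base station -/
  n : ℕ
  /-- number of blocking powers of the adversary -/
  m : ℕ
  /-- the sub-carriers on which a user can be served; these sets may overlap -/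
  chan : Fin N → Finset (Fin Ns)
  one_lt_card_chan : ∀ i, 1 < (chan i).card
  /-- the transmission powers -/
  p : Fin n → ℝ
  /-- the power budget of the base station -/
  pbar : ℝ
  /-- the blocking powers -/
  p' : Fin m → ℝ
  /-- the power budget of the adversary -/
  ptilde : ℝ
  /-- `F i j` is the probability that a packet sent with power `p i` on a sub-carrier which is
  blocked with power `p' j` is nevertheless received -/
  F : Fin n → Fin m → ℝ≥0
  F_le_one : ∀ i j, F i j ≤ 1
  /-- the ages of the users at the first time slot -/
  initAge : Fin N → ℕ
  one_le_initAge : ∀ i, 1 ≤ initAge i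

/-- A `Bool`-valued random variable that is `true` with probability `q`. -/
def coin (q : ℝ≥0) (hq : q ≤ 1) : PMF Bool :=
  PMF.ofFintype (fun b => if b then (q : ℝ≥0∞) else 1 - (q : ℝ≥0∞)) (by
    have h : (q : ℝ≥0∞) ≤ 1 := by exact_mod_cast hq
    simp [add_tsub_cancel_of_le h])

namespace JamNetwork

variable (S : JamNetwork)

/-- Everything that is realized in one time slot. -/
structure Slot where
  /-- the scheduled user -/
  user : Fin S.N
  /-- the sub-carrier used for the transmission -/
  channel : Fin S.Ns
  /-- the transmission power -/
  power : Fin S.n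
  /-- the blocked sub-carrier -/
  blocked : Fin S.Ns
  /-- the blocking power -/
  blockPower : Fin S.m
  /-- whether the scheduled user receives the update packet -/
  received : Bool

/-- The realized past, most recent slot first. The history `h` precedes slot `h.length + 1`. -/
abbrev History := List S.Slot

/-- A (randomized) user choosing policy. -/
abbrev UserPolicy := S.History → PMF (Fin S.N)

/-- A (randomized) sub-carrier choosing policy: once user `i` is scheduled, a sub-carrier
available for user `i` is chosen. -/
abbrev ChannelPolicy := S.History → (i : Fin S.N) → PMF {c // c ∈ S.chan i}

/-- A (randomized) transmission power choosing policy. It may use the past and also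
the user and the sub-carrier that were just chosen. -/
abbrev PowerPolicy := S.History → (i : Fin S.N) → {c // c ∈ S.chan i} → PMF (Fin S.n)

/-- A causal scheduling algorithm of the base station. -/
structure Scheduling where
  /-- user choosing policy -/
  user : S.UserPolicy
  /-- sub-carrier choosing policy -/
  channel : S.ChannelPolicy
  /-- power choosing policy -/
  power : S.PowerPolicy

/-- A causal adversarial action: a sub-carrier blocking policy and a blocking power policy. The
adversary knows the past but not the choices of the base station in the current slot. -/
structure Adversary where
  /-- sub-carrier blocking policy -/
  channel : S.History → PMF (Fin S.Ns)
  /-- blocking power choosing policy -/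
  power : S.History → PMF (Fin S.m)

variable {S}

/-- Law of the reception indicator: a packet on a sub-carrier that is not blocked is received. -/
def receptionLaw (c : Fin S.Ns) (i : Fin S.n) (b : Fin S.Ns) (j : Fin S.m) : PMF Bool :=
  if c = b then coin (S.F i j) (S.F_le_one i j) else PMF.pure true

/-- Conditional law of what happens in a slot, given the past `h`. -/
def slotLaw (π : S.Scheduling) (ψ : S.Adversary) (h : S.History) : PMF S.Slot :=
  (π.user h).bind fun u =>
  (π.channel h u).bind fun c =>
  (π.power h u c).bind fun i =>
  (ψ.channel h).bind fun b =>
  (ψ.power h).bind fun j =>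
  (receptionLaw c.1 i b j).map fun r => ⟨u, c.1, i, b, j, r⟩

/-- Law of the history of the first `t` time slots. -/
def historyLaw (π : S.Scheduling) (ψ : S.Adversary) : ℕ → PMF S.History
  | 0 => PMF.pure []
  | t + 1 => (historyLaw π ψ t).bind fun h => (slotLaw π ψ h).map fun s => s :: h

/-- The age of user `i` right after the history `h`, that is, at time slot `h.length + 1`. -/
def age : S.History → Fin S.N → ℕ
  | [], i => S.initAge i
  | s :: h, i => if s.user = i ∧ s.received = true then 1 else age h i + 1

/-- The expected age of user `i` at time slot `t + 1`. -/
def expectedAge (π : S.Scheduling) (ψ : S.Adversary) (t : ℕ) (i : Fin S.N) : ℝ≥0∞ :=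
  ∑' h : S.History, historyLaw π ψ t h * (age h i : ℝ≥0∞)

/-- The average age of the system: the limit superior, as `T → ∞`, of the mean over the slots
`1, …, T` and over the users of the expected age. -/
def averageAge (π : S.Scheduling) (ψ : S.Adversary) : ℝ≥0∞ :=
  limsup (fun T : ℕ =>
    (∑ t ∈ Finset.range T, (∑ i : Fin S.N, expectedAge π ψ t i) / (S.N : ℝ≥0∞)) / (T : ℝ≥0∞))
    atTop

/-- The mean of the transmission power if it is drawn from the pmf `e`. -/
def meanPower (e : PMF (Fin S.n)) : ℝ := ∑ i, (e i).toReal * S.p i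

/-- Law of the transmission power in a slot, given the past `h`. -/
def powerLawGiven (π : S.Scheduling) (h : S.History) : PMF (Fin S.n) :=
  (π.user h).bind fun u => (π.channel h u).bind fun c => π.power h u c

/-- Law of the transmission power at time slot `t + 1`. -/
def powerLaw (π : S.Scheduling) (ψ : S.Adversary) (t : ℕ) : PMF (Fin S.n) :=
  (historyLaw π ψ t).bind fun h => powerLawGiven π h

/-- The power constraint, with the probabilities of the powers taken at each time slot. -/
def MeetsPowerConstraint (π : S.Scheduling) (ψ : S.Adversary) : Prop :=
  ∀ t, meanPower (powerLaw π ψ t) ≤ S.pbar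

/-- The power constraint, with the probabilities of the powers taken at each time slot
conditionally on the past. -/
def MeetsCondPowerConstraint (π : S.Scheduling) : Prop :=
  ∀ h, meanPower (powerLawGiven π h) ≤ S.pbar

/-- A power choosing policy that in slot `t` uses the pmf `e t`, whatever happened before. -/
def scheduledPower (e : ℕ → PMF (Fin S.n)) : S.PowerPolicy := fun h _ _ => e (h.length + 1)

theorem exists_max_age (h : S.History) :
    (Finset.univ.filter fun i : Fin S.N => ∀ j, age h j ≤ age h i).Nonempty := by
  have : Nonempty (Fin S.N) := ⟨⟨0, lt_trans Nat.zero_lt_one S.one_lt_N⟩⟩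
  obtain ⟨i, hi⟩ := Finite.exists_max (age h)
  exact ⟨i, by simpa using hi⟩

/-- The user of maximum age; among several such users, the one with the lowest index. -/
def maxAgeUser (h : S.History) : Fin S.N :=
  (Finset.univ.filter fun i : Fin S.N => ∀ j, age h j ≤ age h i).min' (exists_max_age h)

variable (S) in
/-- The max-age user choosing policy. -/
def maxAgePolicy : S.UserPolicy := fun h => PMF.pure (maxAgeUser h)

instance (i : Fin S.N) : Nonempty {c // c ∈ S.chan i} :=
  (Finset.card_pos.mp (lt_trans Nat.zero_lt_one (S.one_lt_card_chan i))).to_subtype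

instance : Nonempty (Fin S.Ns) :=
  (inferInstance : Nonempty {c // c ∈ S.chan ⟨0, lt_trans Nat.zero_lt_one S.one_lt_N⟩}).map
    Subtype.val

variable (S) in
/-- The uniform sub-carrier choosing policy. -/
def uniformChannel : S.ChannelPolicy := fun _ i => PMF.uniformOfFintype {c // c ∈ S.chan i}

/-- `x` indexes a blocking power that is the highest among those within the budget. -/
def IsHighestFeasible (x : Fin S.m) : Prop :=
  S.p' x ≤ S.ptilde ∧ ∀ j, S.p' j ≤ S.ptilde → S.p' j ≤ S.p' x

/-- The adversary blocks in each slot a uniformly random one of all the sub-carriers, with the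
blocking power of index `x`. -/
def uniformBlocking (x : Fin S.m) : S.Adversary where
  channel := fun _ => PMF.uniformOfFintype (Fin S.Ns)
  power := fun _ => PMF.pure x

end JamNetwork

end

/-! The blocked sub-carrier is uniform and independent of the choices of the base station, so the
chance of reception depends on the transmission power alone, not on the user or the sub-carrier
(`bind_receptionLaw`). Hence the choices of user and sub-carrier affect the reception pattern only
through the power.

For a given pattern, serving the oldest user is best pathwise: its sorted age vector stays below
that of any other history with the same pattern (`Dominated.ageStep`, `maxAgeAges_dominated`). Under
the max-age policy the ages are a function of the pattern (`age_of_mem_support`), so comparing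
average ages reduces to comparing pattern laws (`averageAge_le`).

The three claims then differ only in the powers. With a fixed sequence of pmfs, all pattern laws
agree. For an arbitrary algorithm, redrawing the power from its conditional law given the pattern
reproduces both the pattern law and the law of the power in each slot. Under the conditional
constraint, one fixed pmf maximizing the reception probability is optimal, as more receptions can
only lower the total max-age. -/

namespace PMF

/-! ### Expectation, disintegration and linear optimization for discrete laws. -/

variable {α β : Type*}

/-- The expectation of a function with values in `[0, ∞]`. -/
noncomputable def expect (p : PMF α) (g : α → ℝ≥0∞) : ℝ≥0∞ := ∑' a, p a * g a

theorem expect_mono (p : PMF α) {f g : α → ℝ≥0∞} (h : ∀ a, f a ≤ g a) :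
    p.expect f ≤ p.expect g :=
  ENNReal.tsum_le_tsum fun a => mul_le_mul_right (h a) _

theorem expect_congr (p : PMF α) {f g : α → ℝ≥0∞} (h : ∀ a ∈ p.support, f a = g a) :
    p.expect f = p.expect g := by
  refine tsum_congr fun a => ?_
  by_cases ha : p a = 0
  · simp [ha]
  · rw [h a ((p.mem_support_iff a).2 ha)]

theorem expect_pure (a : α) (g : α → ℝ≥0∞) : (PMF.pure a).expect g = g a := by
  classical
  unfold expect
  rw [tsum_eq_single a]
  · simp
  · intro b hb
    simp [PMF.pure_apply, hb]

theorem expect_bind (p : PMF α) (f : α → PMF β) (g : β → ℝ≥0∞) :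
    (p.bind f).expect g = p.expect fun a => (f a).expect g := by
  simp only [expect, PMF.bind_apply, ← ENNReal.tsum_mul_right, ← ENNReal.tsum_mul_left, mul_assoc]
  exact ENNReal.tsum_comm

theorem expect_map (p : PMF α) (f : α → β) (g : β → ℝ≥0∞) :
    (p.map f).expect g = p.expect fun a => g (f a) := by
  simp only [PMF.map, expect_bind, Function.comp_apply, expect_pure]

theorem bind_congr_support (p : PMF α) {f g : α → PMF β} (h : ∀ a ∈ p.support, f a = g a) :
    p.bind f = p.bind g := by
  ext b
  simp only [PMF.bind_apply]
  refine tsum_congr fun a => ?_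
  by_cases ha : p a = 0
  · simp [ha]
  · rw [h a ((p.mem_support_iff a).2 ha)]

theorem bool_add (p : PMF Bool) : p true + p false = 1 := by
  have := p.tsum_coe
  rw [tsum_bool] at this
  rw [add_comm, this]

/-- Passing from `p` to `q` moves a mass `d` from `false` to `true`, where `g` is no larger. -/
theorem expect_bool_anti {p q : PMF Bool} (h : p true ≤ q true) {g : Bool → ℝ≥0∞}
    (hg : g true ≤ g false) : q.expect g ≤ p.expect g := by
  simp only [expect, tsum_bool]
  obtain ⟨d, hd⟩ := exists_add_of_le h
  have hf : p false = q false + d := by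
    have h1 := p.bool_add
    rw [← q.bool_add, hd, add_assoc] at h1
    rw [(ENNReal.add_right_inj (p.apply_ne_top true)).1 h1, add_comm]
  rw [hd, hf]
  calc q false * g false + (p true + d) * g true
      = q false * g false + p true * g true + d * g true := by ring
    _ ≤ q false * g false + p true * g true + d * g false := by gcongr
    _ = (q false + d) * g false + p true * g true := by ring

/-- A discrete joint law is the composition of its first marginal with a conditional law. -/
theorem exists_disintegration [Nonempty β] (μ : PMF (α × β)) :
    ∃ κ : α → PMF β, μ = (μ.map Prod.fst).bind fun a => (κ a).map (Prod.mk a) := by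
  classical
  have hfst : ∀ a, (μ.map Prod.fst) a = ∑' b, μ (a, b) := by
    intro a
    rw [PMF.map_apply, ENNReal.tsum_prod', tsum_eq_single a]
    · simp
    · intro a' ha'
      simp [ha'.symm]
  let b₀ : β := Classical.arbitrary β
  -- On null fibres the conditional law is irrelevant, so a point mass serves as default.
  let κ : α → PMF β := fun a =>
    if h : (μ.map Prod.fst) a = 0 then PMF.pure b₀
    else PMF.normalize (fun b => μ (a, b)) (by rwa [← hfst])
      (by rw [← hfst]; exact PMF.apply_ne_top _ _)
  refine ⟨κ, ?_⟩
  ext ⟨a, b⟩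
  rw [PMF.bind_apply, tsum_eq_single a]
  · have hmap : ((κ a).map (Prod.mk a)) (a, b) = κ a b := by
      rw [PMF.map_apply, tsum_eq_single b]
      · simp
      · intro b' hb'
        simp [hb'.symm]
    rw [hmap]
    by_cases h : (μ.map Prod.fst) a = 0
    · rw [h, zero_mul]
      rw [hfst] at h
      exact ENNReal.tsum_eq_zero.1 h b
    · simp only [κ, h, dif_neg, not_false_eq_true, PMF.normalize_apply]
      rw [← hfst, mul_left_comm, ENNReal.mul_inv_cancel h (PMF.apply_ne_top _ _), mul_one]
  · intro a' ha'
    rw [PMF.map_apply]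
    simp [ha'.symm]

/-- On a finite type, a linear functional attains its maximum over the probability mass functions
that satisfy a satisfiable linear constraint. -/
theorem exists_max_of_linear_constraint {n : ℕ} (p : Fin n → ℝ) (c : ℝ) (hp : ∃ i, p i ≤ c)
    (g : Fin n → ℝ) :
    ∃ e : PMF (Fin n), ∑ i, (e i).toReal * p i ≤ c ∧
      ∀ e' : PMF (Fin n), ∑ i, (e' i).toReal * p i ≤ c →
        ∑ i, (e' i).toReal * g i ≤ ∑ i, (e i).toReal * g i := by
  classical
  have hmem : ∀ e : PMF (Fin n), (fun i => (e i).toReal) ∈ stdSimplex ℝ (Fin n) := by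
    intro e
    refine ⟨fun i => ENNReal.toReal_nonneg, ?_⟩
    have h := e.tsum_coe
    rw [tsum_fintype] at h
    rw [← ENNReal.toReal_sum fun i _ => e.apply_ne_top i, h, ENNReal.toReal_one]
  let K : Set (Fin n → ℝ) := stdSimplex ℝ (Fin n) ∩ {v | ∑ i, v i * p i ≤ c}
  have hK : IsCompact K := (isCompact_stdSimplex ℝ (Fin n)).inter_right
    (isClosed_le (by fun_prop) continuous_const)
  have hne : K.Nonempty := by
    obtain ⟨i, hi⟩ := hp
    refine ⟨Pi.single i 1, single_mem_stdSimplex ℝ i, ?_⟩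
    simpa [Pi.single_apply] using hi
  obtain ⟨v, ⟨hv, hvc⟩, hmax⟩ := hK.exists_isMaxOn hne
    (f := fun v : Fin n → ℝ => ∑ i, v i * g i) (by fun_prop)
  have hsum : ∑ i, ENNReal.ofReal (v i) = 1 := by
    rw [← ENNReal.ofReal_sum_of_nonneg fun i _ => hv.1 i, hv.2, ENNReal.ofReal_one]
  have hval : ∀ i, (PMF.ofFintype (fun i => ENNReal.ofReal (v i)) hsum i).toReal = v i := by
    intro i
    rw [PMF.ofFintype_apply, ENNReal.toReal_ofReal (hv.1 i)]
  refine ⟨PMF.ofFintype (fun i => ENNReal.ofReal (v i)) hsum, ?_, fun e' he' => ?_⟩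
  · simp only [hval]
    exact hvc
  · simp only [hval]
    exact hmax (show _ ∈ K from ⟨hmem e', he'⟩)

end PMF

namespace JamNetwork

variable {S : JamNetwork}

/-! ### Dominance of age vectors -/

/-- `a` is bounded by a rearrangement of `b`. -/
def Dominated (a b : Fin S.N → ℕ) : Prop := ∃ σ : Equiv.Perm (Fin S.N), ∀ i, a i ≤ b (σ i)

/-- The ages after a slot in which user `u` is scheduled; `r` tells whether it receives a packet. -/
def ageStep (u : Fin S.N) (r : Bool) (a : Fin S.N → ℕ) : Fin S.N → ℕ :=
  fun i => if u = i ∧ r = true then 1 else a i + 1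

theorem age_cons (s : S.Slot) (h : S.History) :
    age (s :: h) = ageStep s.user s.received (age h) := rfl

theorem Dominated.refl (a : Fin S.N → ℕ) : Dominated a a := ⟨1, fun _ => le_rfl⟩

theorem Dominated.sum_le {a b : Fin S.N → ℕ} (h : Dominated a b) : ∑ i, a i ≤ ∑ i, b i := by
  obtain ⟨σ, hσ⟩ := h
  exact (Finset.sum_le_sum fun i _ => hσ i).trans_eq (Equiv.sum_comp σ b)

/-- Only `u` has to be maximal; `v` is arbitrary. After a reception the two reset users are matched
with each other, and their former partners `σ.symm v` and `σ u` are paired: `a (σ.symm v) ≤ a u ≤ b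
(σ u)`. -/
theorem Dominated.ageStep {a b : Fin S.N → ℕ} (h : Dominated a b) {u : Fin S.N}
    (hu : ∀ j, a j ≤ a u) (v : Fin S.N) (r : Bool) :
    Dominated (ageStep u r a) (ageStep v r b) := by
  obtain ⟨σ, hσ⟩ := h
  cases r with
  | false => exact ⟨σ, fun i => by simpa [JamNetwork.ageStep] using hσ i⟩
  | true =>
    refine ⟨(Equiv.swap u (σ.symm v)).trans σ, fun i => ?_⟩
    simp only [JamNetwork.ageStep, and_true, Equiv.trans_apply]
    by_cases hi : u = i
    · subst hi
      simp
    · rw [if_neg hi]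
      by_cases hv : i = σ.symm v
      · subst hv
        have hne : v ≠ σ u := fun h => hi (by rw [h, Equiv.symm_apply_apply])
        rw [Equiv.swap_apply_right, if_neg hne]
        exact Nat.succ_le_succ ((hu _).trans (hσ u))
      · have hne : v ≠ σ i := fun h => hv (by rw [h, Equiv.symm_apply_apply])
        rw [Equiv.swap_apply_of_ne_of_ne (Ne.symm hi) hv, if_neg hne]
        exact Nat.succ_le_succ (hσ i)

theorem ageStep_true_dominated (u v : Fin S.N) (a : Fin S.N → ℕ) :
    Dominated (ageStep u true a) (ageStep v false a) := by
  refine ⟨1, fun i => ?_⟩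
  simp only [ageStep, and_true, Equiv.Perm.coe_one, id]
  split_ifs <;> simp_all

theorem exists_top (a : Fin S.N → ℕ) :
    (Finset.univ.filter fun i : Fin S.N => ∀ j, a j ≤ a i).Nonempty := by
  have : Nonempty (Fin S.N) := ⟨⟨0, lt_trans Nat.zero_lt_one S.one_lt_N⟩⟩
  obtain ⟨i, hi⟩ := Finite.exists_max a
  exact ⟨i, by simpa using hi⟩

/-- The lowest index at which an age vector is maximal. -/
def topUser (a : Fin S.N → ℕ) : Fin S.N :=
  (Finset.univ.filter fun i : Fin S.N => ∀ j, a j ≤ a i).min' (exists_top a)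

theorem le_topUser (a : Fin S.N → ℕ) (j : Fin S.N) : a j ≤ a (topUser a) :=
  (Finset.mem_filter.1 (Finset.min'_mem _ (exists_top a))).2 j

theorem maxAgeUser_eq_topUser (h : S.History) : maxAgeUser h = topUser (age h) := rfl

variable (S) in
/-- The ages under the max-age policy, as a function of the pattern of receptions (most recent slot
first). -/
def maxAgeAges : List Bool → Fin S.N → ℕ
  | [] => S.initAge
  | r :: rs => ageStep (topUser (maxAgeAges rs)) r (maxAgeAges rs)

/-- The pattern of receptions in a history. -/
def pattern (h : S.History) : List Bool := h.map Slot.received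

/-- Coupling through a common reception pattern, valid for every single history and hence for every
policy. -/
theorem maxAgeAges_dominated (h : S.History) : Dominated (S.maxAgeAges (pattern h)) (age h) := by
  induction h with
  | nil => exact Dominated.refl _
  | cons s h ih => exact ih.ageStep (le_topUser _) s.user s.received

/-- The slots in `l` are later than the altered one: the advantage of one extra reception survives
all subsequent max-age steps. -/
theorem maxAgeAges_append_dominated (l rs : List Bool) :
    Dominated (S.maxAgeAges (l ++ true :: rs)) (S.maxAgeAges (l ++ false :: rs)) := by
  induction l with
  | nil => exact ageStep_true_dominated _ _ _
  | cons r l ih => exact ih.ageStep (le_topUser _) _ r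

variable (S) in
/-- The total age under the max-age policy. -/
def totalMaxAge (rs : List Bool) : ℝ≥0∞ := ((∑ i, S.maxAgeAges rs i : ℕ) : ℝ≥0∞)

theorem totalMaxAge_le (h : S.History) :
    S.totalMaxAge (pattern h) ≤ ((∑ i, age h i : ℕ) : ℝ≥0∞) :=
  Nat.cast_le.2 (maxAgeAges_dominated h).sum_le

/-! ### The law of the receptions -/

/-- The law of the reception indicator, given the transmission power, against uniform blocking. -/
noncomputable def receptionGivenPower (x : Fin S.m) (i : Fin S.n) : PMF Bool :=
  (PMF.uniformOfFintype (Fin S.Ns)).bind fun b =>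
    receptionLaw (Classical.arbitrary (Fin S.Ns)) i b x

/-- The transposition of `c` and the reference sub-carrier preserves the uniform law of the blocked
one. -/
theorem bind_receptionLaw (x : Fin S.m) (i : Fin S.n) (c : Fin S.Ns) :
    ((PMF.uniformOfFintype (Fin S.Ns)).bind fun b => receptionLaw c i b x) =
      receptionGivenPower x i := by
  ext r
  simp only [receptionGivenPower, PMF.bind_apply, PMF.uniformOfFintype_apply, tsum_fintype,
    ← Finset.mul_sum]
  congr 1
  set d : Fin S.Ns := Classical.arbitrary (Fin S.Ns)
  rw [← Equiv.sum_comp (Equiv.swap c d)]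
  refine Finset.sum_congr rfl fun b _ => ?_
  have h : c = Equiv.swap c d b ↔ d = b := by
    rw [← Equiv.symm_apply_eq, Equiv.symm_swap, Equiv.swap_apply_left]
  simp only [receptionLaw, h]

theorem slotLaw_map_received (π : S.Scheduling) (x : Fin S.m) (h : S.History) :
    (slotLaw π (uniformBlocking x) h).map Slot.received =
      (powerLawGiven π h).bind (receptionGivenPower x) := by
  simp only [slotLaw, powerLawGiven, uniformBlocking, PMF.map_bind, PMF.bind_bind, PMF.pure_bind,
    PMF.map_comp]
  congr 1; funext u; congr 1; funext c; congr 1; funext i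
  rw [← bind_receptionLaw x i c.1]
  congr 1; funext b
  exact PMF.map_id _

/-- The law of the pattern of receptions in the first `t` time slots. -/
noncomputable def patternLaw (π : S.Scheduling) (x : Fin S.m) (t : ℕ) : PMF (List Bool) :=
  (historyLaw π (uniformBlocking x) t).map pattern

theorem patternLaw_zero (π : S.Scheduling) (x : Fin S.m) : patternLaw π x 0 = PMF.pure [] := by
  simp [patternLaw, historyLaw, PMF.pure_map, pattern]

theorem patternLaw_succ (π : S.Scheduling) (x : Fin S.m) (t : ℕ) :
    patternLaw π x (t + 1) = (historyLaw π (uniformBlocking x) t).bind fun h =>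
      ((powerLawGiven π h).bind (receptionGivenPower x)).map (· :: pattern h) := by
  simp only [patternLaw, historyLaw, PMF.map_bind, ← slotLaw_map_received, PMF.map_comp]
  rfl

/-- The law of the pattern of receptions in the first `t` time slots if the power is drawn from
`w rs` after the pattern `rs`. -/
noncomputable def chainLaw (x : Fin S.m) (w : List Bool → PMF (Fin S.n)) : ℕ → PMF (List Bool)
  | 0 => PMF.pure []
  | t + 1 => (chainLaw x w t).bind fun rs => ((w rs).bind (receptionGivenPower x)).map (· :: rs)

theorem patternLaw_eq_chainLaw {π : S.Scheduling} (x : Fin S.m) {w : List Bool → PMF (Fin S.n)}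
    (hw : ∀ h, powerLawGiven π h = w (pattern h)) (t : ℕ) :
    patternLaw π x t = chainLaw x w t := by
  induction t with
  | zero => exact patternLaw_zero π x
  | succ t ih =>
    rw [patternLaw_succ, chainLaw, ← ih, patternLaw, PMF.bind_map]
    simp only [hw]
    rfl

theorem length_of_mem_support (π : S.Scheduling) (ψ : S.Adversary) (t : ℕ) (h : S.History)
    (hh : h ∈ (historyLaw π ψ t).support) : h.length = t := by
  induction t generalizing h with
  | zero => simp_all [historyLaw]
  | succ t ih =>
    simp only [historyLaw, PMF.mem_support_bind_iff, PMF.mem_support_map_iff] at hh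
    obtain ⟨h', hh', s, -, rfl⟩ := hh
    simp [ih h' hh']

/-- This turns the bound `totalMaxAge_le` into an equality for the max-age policy. -/
theorem age_of_mem_support {π : S.Scheduling} (hπ : π.user = S.maxAgePolicy) (ψ : S.Adversary)
    (t : ℕ) (h : S.History) (hh : h ∈ (historyLaw π ψ t).support) :
    age h = S.maxAgeAges (pattern h) := by
  induction t generalizing h with
  | zero =>
    have : h = [] := by simpa [historyLaw] using hh
    subst this
    rfl
  | succ t ih =>
    simp only [historyLaw, PMF.mem_support_bind_iff, PMF.mem_support_map_iff] at hh
    obtain ⟨h', hh', s, hs, rfl⟩ := hh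
    have hu : s.user = maxAgeUser h' := by
      simp only [slotLaw, hπ, maxAgePolicy, PMF.pure_bind, PMF.mem_support_bind_iff,
        PMF.mem_support_map_iff] at hs
      obtain ⟨c, -, i, -, b, -, j, -, r, -, rfl⟩ := hs
      rfl
    rw [age_cons, hu, maxAgeUser_eq_topUser, ih h' hh']
    rfl

/-! ### Expected ages -/

theorem sum_expectedAge (π : S.Scheduling) (ψ : S.Adversary) (t : ℕ) :
    ∑ i, expectedAge π ψ t i =
      (historyLaw π ψ t).expect fun h => ((∑ i, age h i : ℕ) : ℝ≥0∞) := by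
  simp only [expectedAge, PMF.expect]
  rw [← Summable.tsum_finsetSum fun _ _ => ENNReal.summable]
  simp only [Nat.cast_sum, Finset.mul_sum]

theorem expect_totalMaxAge_le (π : S.Scheduling) (x : Fin S.m) (t : ℕ) :
    (patternLaw π x t).expect S.totalMaxAge ≤
      ∑ i, expectedAge π (uniformBlocking x) t i := by
  rw [sum_expectedAge, patternLaw, PMF.expect_map]
  exact PMF.expect_mono _ totalMaxAge_le

theorem sum_expectedAge_maxAge {π : S.Scheduling} (hπ : π.user = S.maxAgePolicy) (x : Fin S.m)
    (t : ℕ) : ∑ i, expectedAge π (uniformBlocking x) t i =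
      (patternLaw π x t).expect S.totalMaxAge := by
  rw [sum_expectedAge, patternLaw, PMF.expect_map]
  refine PMF.expect_congr _ fun h hh => ?_
  rw [age_of_mem_support hπ _ t h hh]
  rfl

theorem averageAge_le {π π' : S.Scheduling} (hπ : π.user = S.maxAgePolicy) (x : Fin S.m)
    (h : ∀ t, (patternLaw π x t).expect S.totalMaxAge ≤
      (patternLaw π' x t).expect S.totalMaxAge) :
    averageAge π (uniformBlocking x) ≤ averageAge π' (uniformBlocking x) := by
  refine limsup_le_limsup (Eventually.of_forall fun T => ?_)
  refine ENNReal.div_le_div_right (Finset.sum_le_sum fun t _ => ?_) _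
  refine ENNReal.div_le_div_right ?_ _
  rw [sum_expectedAge_maxAge hπ]
  exact (h t).trans (expect_totalMaxAge_le π' x t)

/-! ### Powers given by a fixed sequence -/

theorem powerLawGiven_of_const (υ : S.UserPolicy) (σ : S.ChannelPolicy)
    (w : S.History → PMF (Fin S.n))
    (h : S.History) : powerLawGiven ⟨υ, σ, fun h _ _ => w h⟩ h = w h := by
  simp only [powerLawGiven, PMF.bind_const]

theorem averageAge_le_of_scheduledPower (e : ℕ → PMF (Fin S.n)) (x : Fin S.m) (υ : S.UserPolicy)
    (σ σ' : S.ChannelPolicy) :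
    averageAge ⟨S.maxAgePolicy, σ, scheduledPower e⟩ (uniformBlocking x) ≤
      averageAge ⟨υ, σ', scheduledPower e⟩ (uniformBlocking x) := by
  refine averageAge_le rfl x fun t => le_of_eq ?_
  -- The slot number can be read off the length of the pattern, so the power is a function of the
  -- pattern.
  have key : ∀ υ σ, patternLaw ⟨υ, σ, scheduledPower e⟩ x t =
      chainLaw x (fun rs => e (rs.length + 1)) t := fun υ σ =>
    patternLaw_eq_chainLaw x (fun h => by
      simp only [pattern, List.length_map]
      exact powerLawGiven_of_const υ σ _ h) t
  rw [key, key]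

/-! ### Powers drawn from the conditional law given the receptions -/

/-- The joint law of the receptions in the first `t` slots and the power in the next slot. -/
noncomputable def jointLaw (π : S.Scheduling) (x : Fin S.m) (t : ℕ) : PMF (List Bool × Fin S.n) :=
  (historyLaw π (uniformBlocking x) t).bind fun h => (powerLawGiven π h).map (Prod.mk (pattern h))

theorem jointLaw_map_fst (π : S.Scheduling) (x : Fin S.m) (t : ℕ) :
    (jointLaw π x t).map Prod.fst = patternLaw π x t := by
  rw [jointLaw, PMF.map_bind, patternLaw, PMF.map]
  congr 1
  funext h
  rw [PMF.map_comp]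
  exact PMF.map_const _ _

theorem jointLaw_map_snd (π : S.Scheduling) (x : Fin S.m) (t : ℕ) :
    (jointLaw π x t).map Prod.snd = powerLaw π (uniformBlocking x) t := by
  rw [jointLaw, PMF.map_bind, powerLaw]
  congr 1
  funext h
  rw [PMF.map_comp]
  exact PMF.map_id _

theorem patternLaw_succ_eq_jointLaw_bind (π : S.Scheduling) (x : Fin S.m) (t : ℕ) :
    patternLaw π x (t + 1) =
      (jointLaw π x t).bind fun y => (receptionGivenPower x y.2).map (· :: y.1) := by
  simp only [patternLaw_succ, jointLaw, PMF.bind_bind, PMF.bind_map, PMF.map_bind]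
  rfl

theorem exists_conditional_power [Nonempty (Fin S.n)] (π : S.Scheduling) (x : Fin S.m) :
    ∃ w : List Bool → PMF (Fin S.n), ∀ t,
      jointLaw π x t = (patternLaw π x t).bind fun rs => (w rs).map (Prod.mk rs) := by
  choose κ hκ using fun t => (jointLaw π x t).exists_disintegration
  -- The kernels for the various slots merge into one, since a pattern of positive probability at
  -- time `t` has length `t`.
  refine ⟨fun rs => κ rs.length rs, fun t => ?_⟩
  conv_lhs => rw [hκ t, jointLaw_map_fst]
  refine PMF.bind_congr_support _ fun rs hrs => ?_
  obtain ⟨h, hh, rfl⟩ := (PMF.mem_support_map_iff _ _ _).1 hrs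
  have hl : (pattern h).length = t := by
    rw [pattern, List.length_map, length_of_mem_support π _ t h hh]
  simp only [hl]

theorem patternLaw_eq_chainLaw_of_jointLaw {π : S.Scheduling} {x : Fin S.m}
    {w : List Bool → PMF (Fin S.n)}
    (hw : ∀ t, jointLaw π x t = (patternLaw π x t).bind fun rs => (w rs).map (Prod.mk rs))
    (t : ℕ) : patternLaw π x t = chainLaw x w t := by
  induction t with
  | zero => exact patternLaw_zero π x
  | succ t ih =>
    rw [patternLaw_succ_eq_jointLaw_bind, hw, chainLaw, ← ih]
    simp only [PMF.bind_bind, PMF.bind_map, PMF.map_bind]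
    rfl

theorem powerLaw_eq_bind_of_jointLaw {π : S.Scheduling} {x : Fin S.m}
    {w : List Bool → PMF (Fin S.n)}
    (hw : ∀ t, jointLaw π x t = (patternLaw π x t).bind fun rs => (w rs).map (Prod.mk rs))
    (t : ℕ) : powerLaw π (uniformBlocking x) t = (patternLaw π x t).bind w := by
  rw [← jointLaw_map_snd, hw, PMF.map_bind]
  congr 1
  funext rs
  rw [PMF.map_comp]
  exact PMF.map_id _

theorem exists_power_of_meetsPowerConstraint [Nonempty (Fin S.n)] (x : Fin S.m)
    (π : S.Scheduling) (hπ : MeetsPowerConstraint π (uniformBlocking x)) :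
    ∃ ρ : S.PowerPolicy,
      MeetsPowerConstraint ⟨S.maxAgePolicy, S.uniformChannel, ρ⟩ (uniformBlocking x) ∧
      averageAge ⟨S.maxAgePolicy, S.uniformChannel, ρ⟩ (uniformBlocking x) ≤
        averageAge π (uniformBlocking x) := by
  obtain ⟨w, hw⟩ := exists_conditional_power π x
  have hgiven : ∀ h, powerLawGiven
      ⟨S.maxAgePolicy, S.uniformChannel, fun h _ _ => w (pattern h)⟩ h = w (pattern h) :=
    powerLawGiven_of_const _ _ _
  have hlaw : ∀ t, patternLaw ⟨S.maxAgePolicy, S.uniformChannel, fun h _ _ => w (pattern h)⟩ x t =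
      patternLaw π x t := fun t => by
    rw [patternLaw_eq_chainLaw x hgiven, patternLaw_eq_chainLaw_of_jointLaw hw]
  refine ⟨fun h _ _ => w (pattern h), fun t => ?_, averageAge_le rfl x fun t => by rw [hlaw]⟩
  have hpow : powerLaw ⟨S.maxAgePolicy, S.uniformChannel, fun h _ _ => w (pattern h)⟩
      (uniformBlocking x) t = powerLaw π (uniformBlocking x) t := by
    rw [powerLaw_eq_bind_of_jointLaw hw, ← hlaw, patternLaw, PMF.bind_map, powerLaw]
    simp only [hgiven]
    rfl
  rw [hpow]
  exact hπ t

/-! ### Powers that maximize the probability of reception -/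

variable (S) in
/-- The expected total age under the max-age policy after `k` more slots with independent
receptions of law `q`. -/
noncomputable def futureAge (q : PMF Bool) : ℕ → List Bool → ℝ≥0∞
  | 0, rs => S.totalMaxAge rs
  | k + 1, rs => q.expect fun r => futureAge q k (r :: rs)

/-- The prefix `l` makes the induction work: each further slot prepends its outcome to it. -/
theorem futureAge_append_le (q : PMF Bool) (k : ℕ) (l rs : List Bool) :
    S.futureAge q k (l ++ true :: rs) ≤ S.futureAge q k (l ++ false :: rs) := by
  induction k generalizing l with
  | zero => exact Nat.cast_le.2 (maxAgeAges_append_dominated l rs).sum_le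
  | succ k ih => exact PMF.expect_mono _ fun r => ih (r :: l)

theorem expect_chainLaw_futureAge (x : Fin S.m) (e : PMF (Fin S.n)) (t k : ℕ) :
    (chainLaw x (fun _ => e) t).expect (S.futureAge (e.bind (receptionGivenPower x)) k) =
      S.futureAge (e.bind (receptionGivenPower x)) (t + k) [] := by
  induction t generalizing k with
  | zero => rw [chainLaw, PMF.expect_pure, zero_add]
  | succ t ih =>
    rw [add_right_comm, add_assoc, ← ih, chainLaw, PMF.expect_bind]
    simp only [PMF.expect_map]
    rfl

/-- Slot-by-slot exchange: replacing the law of the reception in one slot by `q`, with only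
`q`-slots to follow, cannot raise the expected total age. -/
theorem futureAge_le_expect_patternLaw {π : S.Scheduling} (x : Fin S.m) {q : PMF Bool}
    (hq : ∀ h, ((powerLawGiven π h).bind (receptionGivenPower x)) true ≤ q true) (t k : ℕ) :
    S.futureAge q (t + k) [] ≤ (patternLaw π x t).expect (S.futureAge q k) := by
  induction t generalizing k with
  | zero => rw [patternLaw_zero, PMF.expect_pure, zero_add]
  | succ t ih =>
    rw [add_right_comm, add_assoc]
    refine (ih (k + 1)).trans ?_
    rw [patternLaw_succ, PMF.expect_bind, patternLaw, PMF.expect_map]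
    refine PMF.expect_mono _ fun h => ?_
    rw [PMF.expect_map]
    exact PMF.expect_bool_anti (hq h) (futureAge_append_le q k [] (pattern h))

theorem toReal_bind_apply {n : ℕ} {β : Type*} (e : PMF (Fin n)) (f : Fin n → PMF β) (b : β) :
    ((e.bind f) b).toReal = ∑ i, (e i).toReal * (f i b).toReal := by
  rw [PMF.bind_apply, tsum_fintype,
    ENNReal.toReal_sum fun i _ => ENNReal.mul_ne_top (e.apply_ne_top i) ((f i).apply_ne_top b)]
  simp only [ENNReal.toReal_mul]

theorem exists_optimal_power (x : Fin S.m) (hp : ∃ i, S.p i ≤ S.pbar) :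
    ∃ ρ : S.PowerPolicy,
      MeetsCondPowerConstraint ⟨S.maxAgePolicy, S.uniformChannel, ρ⟩ ∧
      ∀ π : S.Scheduling, MeetsCondPowerConstraint π →
        averageAge ⟨S.maxAgePolicy, S.uniformChannel, ρ⟩ (uniformBlocking x) ≤
          averageAge π (uniformBlocking x) := by
  -- The reception probability is linear in the power pmf, and the constraint is the same after
  -- every past, so a single `e` is best everywhere.
  obtain ⟨e, he, hmax⟩ := PMF.exists_max_of_linear_constraint S.p S.pbar hp
    fun i => (receptionGivenPower x i true).toReal
  have hgiven : ∀ h, powerLawGiven ⟨S.maxAgePolicy, S.uniformChannel, fun _ _ _ => e⟩ h = e :=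
    powerLawGiven_of_const _ _ fun _ => e
  refine ⟨fun _ _ _ => e, fun h => by rw [hgiven]; exact he, fun π hπ => ?_⟩
  refine averageAge_le rfl x fun t => ?_
  rw [patternLaw_eq_chainLaw x (w := fun _ => e) hgiven]
  refine (expect_chainLaw_futureAge x e t 0).trans_le (futureAge_le_expect_patternLaw x ?_ t 0)
  intro h
  rw [← ENNReal.toReal_le_toReal (PMF.apply_ne_top _ _) (PMF.apply_ne_top _ _),
    toReal_bind_apply, toReal_bind_apply]
  exact hmax _ (hπ h)

end JamNetwork

theorem lemma1 (S : JamNetwork) (x : Fin S.m) (hx : JamNetwork.IsHighestFeasible x)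
    (hp : ∃ i, S.p i ≤ S.pbar) :
    -- for each sequence of transmission power pmfs: the max-age policy is an optimal user choosing
    -- policy, and with it the uniform policy is an optimal sub-carrier choosing policy
    (∀ e : ℕ → PMF (Fin S.n),
      (∀ (υ : S.UserPolicy) (σ : S.ChannelPolicy),
        JamNetwork.averageAge ⟨S.maxAgePolicy, σ, JamNetwork.scheduledPower e⟩
            (JamNetwork.uniformBlocking x) ≤
          JamNetwork.averageAge ⟨υ, σ, JamNetwork.scheduledPower e⟩
            (JamNetwork.uniformBlocking x)) ∧
      (∀ σ : S.ChannelPolicy,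
        JamNetwork.averageAge ⟨S.maxAgePolicy, S.uniformChannel, JamNetwork.scheduledPower e⟩
            (JamNetwork.uniformBlocking x) ≤
          JamNetwork.averageAge ⟨S.maxAgePolicy, σ, JamNetwork.scheduledPower e⟩
            (JamNetwork.uniformBlocking x))) ∧
    -- jointly with the choice of powers, power constraint at each slot: nothing is lost by using
    -- the max-age policy and the uniform policy
    (∀ π : S.Scheduling, JamNetwork.MeetsPowerConstraint π (JamNetwork.uniformBlocking x) →
      ∃ ρ : S.PowerPolicy,
        JamNetwork.MeetsPowerConstraint ⟨S.maxAgePolicy, S.uniformChannel, ρ⟩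
          (JamNetwork.uniformBlocking x) ∧
        JamNetwork.averageAge ⟨S.maxAgePolicy, S.uniformChannel, ρ⟩
            (JamNetwork.uniformBlocking x) ≤
          JamNetwork.averageAge π (JamNetwork.uniformBlocking x)) ∧
    -- jointly with the choice of powers, power constraint at each slot given the past: some
    -- optimal scheduling algorithm uses the max-age policy and the uniform policy
    (∃ ρ : S.PowerPolicy,
      JamNetwork.MeetsCondPowerConstraint ⟨S.maxAgePolicy, S.uniformChannel, ρ⟩ ∧
      ∀ π : S.Scheduling, JamNetwork.MeetsCondPowerConstraint π →
        JamNetwork.averageAge ⟨S.maxAgePolicy, S.uniformChannel, ρ⟩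
            (JamNetwork.uniformBlocking x) ≤
          JamNetwork.averageAge π (JamNetwork.uniformBlocking x)) := by
  have : Nonempty (Fin S.n) := ⟨hp.choose⟩
  exact ⟨fun e => ⟨fun υ σ => JamNetwork.averageAge_le_of_scheduledPower e x υ σ σ,
      fun σ => JamNetwork.averageAge_le_of_scheduledPower e x _ _ σ⟩,
    JamNetwork.exists_power_of_meetsPowerConstraint x, JamNetwork.exists_optimal_power x hp⟩
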